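/- Let $S$ be a monoid, let $G$ be a non-trivial discrete group with identity $e$, and let $\sigma\colon S\to\mathrm{End}(G)$ be an injective monoid homomorphism such that each $\sigma_s$ is injective and at least one $\sigma_s$ is not an automorphism (a faithful non-automorphic algebraic action). Let $I$ be the inverse semigroup of partial bijections of $G$ generated by the maps $\sigma_s$ ($s\in S$) and the left translations $h\mapsto gh$ ($g\in G$). Let $\mathcal E$ be the semilattice of idempotents of $I$; an idempotent is identified with its domain, so that $\mathcal E$ is a family of subsets of $G$ with product $\cap$. Let $\mathcal C$ be the smallest family of subgroups of $G$ that contains $G$ and is closed under $C\mapsto\sigma_s(C)$ and $C\mapsto\sigma_s^{-1}(C)$ for all $s\in S$. The members of $\mathcal E$, which are $\emptyset$ and the cosets $gC$ with $g\in G$ and $C\in\mathcal C$, are called constructible cosets. Let $\widehat{\mathcal E}$ be the space of non-zero multiplicative maps $\chi\colon\mathcal E\to\{0,1\}$ with $\chi(\emptyset)=0$, with the topology of pointwise convergence, and let $\partial\widehat{\mathcal E}$ be the closure of the set of those $\chi$ for which the filter $\{X\in\mathcal E:\chi(X)=1\}$ is maximal with respect to inclusion. For $\phi\in I$ and $\chi\in\widehat{\mathcal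 E}$ with $\chi(\mathrm{dom}(\phi))=1$, put $(\phi.\chi)(X)=\chi(\phi^{-1}(X))$. Let $I\ltimes\widehat{\mathcal E}$ be the groupoid of classes $[\phi,\chi]$ of pairs $(\phi,\chi)\in I\times\widehat{\mathcal E}$ with $\chi(\mathrm{dom}(\phi))=1$, where $(\phi,\chi)\sim(\psi,\omega)$ if and only if $\chi=\omega$ and $\phi|_X=\psi|_X$ for some non-empty $X\in\mathcal E$ with $\chi(X)=1$. Its source and range maps are $[\phi,\chi]\mapsto\chi$ and $[\phi,\chi]\mapsto\phi.\chi$, its multiplication is $[\phi,\psi.\chi][\psi,\chi]=[\phi\psi,\chi]$, its inversion is $[\phi,\chi]^{-1}=[\phi^{-1},\phi.\chi]$, and its topology has as a basis the sets $$\{[\phi,\chi] : \chi\in\widehat{\mathcal E}(X;F)\},\qquad \widehat{\mathcal E}(X;F)=\{\chi\in\widehat{\mathcal E}:\chi(X)=1,\ \chi(Y)=0\text{ for all }Y\in F\},$$ where $\phi\in I$, $X\in\mathcal E$, and $F\subseteq\mathcal E$ is finite, such that $\chi(\mathrm{dom}(\phi))=1$ for all $\chi\in\widehat{\mathcal E}(X;F)$.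 Let $\mathcal G_\sigma=\{\gamma\in I\ltimes\widehat{\mathcal E} : \text{the source and the range of }\gamma\text{ lie in }\partial\widehat{\mathcal E}\}$, with the subspace topology. Then $\mathcal G_\sigma$ is Hausdorff if and only if the following condition (H) holds: for every $\phi\in I$, with $\mathrm{fix}(\phi)=\{g\in\mathrm{dom}(\phi):\phi(g)=g\}$, there are finitely many (possibly zero) cosets $g_1C_1,\dots,g_nC_n\subseteq\mathrm{fix}(\phi)$ with $g_i\in G$ and $C_i\in\mathcal C$ such that $\bigcup_{i=1}^n g_iC_i$ is the union of all constructible cosets contained in $\mathrm{fix}(\phi)$. -/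

import Mathlib

open scoped Pointwise

namespace AlgAct

universe u v

/-- An algebraic action of a monoid `S` on a group `G`: a homomorphism from `S` to the monoid of
endomorphisms of `G` such that every `σ s` is injective. -/
structure AlgebraicAction (S : Type u) (G : Type v) [Monoid S] [Group G] where
  /-- the underlying homomorphism -/
  toHom : S →* Monoid.End G
  /-- each endomorphism is injective -/
  injective : ∀ s : S, Function.Injective (toHom s)

variable {S : Type u} {G : Type v} [Monoid S] [Group G]

/-- The action is faithful if `s ↦ σ s` is injective. -/
def AlgebraicAction.IsFaithful (σ : AlgebraicAction S G) : Prop :=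
  Function.Injective σ.toHom

/-- The action is automorphic if every `σ s` is an automorphism of `G`. -/
def AlgebraicAction.IsAutomorphic (σ : AlgebraicAction S G) : Prop :=
  ∀ s : S, Function.Bijective (σ.toHom s)

/-! ### Partial bijections -/

/-- The domain of a partial bijection. -/
def dom (φ : G ≃. G) : Set G := {g | ∃ h, h ∈ φ g}

/-- The set of fixed points of a partial bijection. -/
def fixSet (φ : G ≃. G) : Set G := {g | g ∈ φ g}

/-- The endomorphism `σ s`, viewed as a partial bijection of `G` with domain `G`. -/
noncomputable def endo (σ : AlgebraicAction S G) (s : S) : G ≃. G where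
  toFun g := some (σ.toHom s g)
  invFun := Function.partialInv (σ.toHom s)
  inv a b := by
    have h := (σ.injective s).isPartialInv a b
    simp only [Option.some.injEq]
    exact h

/-- The translation `h ↦ g * h`, viewed as a partial bijection of `G`. -/
def transl (g : G) : G ≃. G := (Equiv.mulLeft g).toPEquiv

/-- `IsGen σ φ` says that `φ` belongs to the inverse semigroup `I` of partial bijections of `G`
that is generated by the endomorphisms `σ s` and the translations.
Note that `φ.trans ψ` is the partial bijection `ψ ∘ φ`. -/
inductive IsGen (σ : AlgebraicAction S G) : (G ≃. G) → Prop
  | endo (s : S) : IsGen σ (endo σ s)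
  | transl (g : G) : IsGen σ (transl g)
  | comp {φ ψ : G ≃. G} : IsGen σ φ → IsGen σ ψ → IsGen σ (φ.trans ψ)
  | inv {φ : G ≃. G} : IsGen σ φ → IsGen σ φ.symm

/-- The inverse semigroup `I` of the action. -/
abbrev InvSgp (σ : AlgebraicAction S G) : Type v := {φ : G ≃. G // IsGen σ φ}

namespace InvSgp

variable {σ : AlgebraicAction S G}

/-- The product `φ ψ` in `I`, i.e. first `ψ`, then `φ`. -/
def mul (φ ψ : InvSgp σ) : InvSgp σ := ⟨ψ.1.trans φ.1, ψ.2.comp φ.2⟩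

/-- The inverse of an element of `I`. -/
def inv (φ : InvSgp σ) : InvSgp σ := ⟨φ.1.symm, φ.2.inv⟩

/-- The identity map of `G`, as an element of `I`. -/
def one : InvSgp σ := ⟨PEquiv.refl G, by
  have h := IsGen.transl (σ := σ) (1 : G)
  have e : AlgAct.transl (1 : G) = PEquiv.refl G := by
    ext a b
    simp [AlgAct.transl, Equiv.toPEquiv]
  rwa [e] at h⟩

end InvSgp

/-! ### Constructible subgroups and the semilattice of idempotents -/

/-- `IsConstructible σ C` says that `C` lies in the smallest family of subgroups of `G` that
contains `G` and is closed under images and preimages under the endomorphisms `σ s`. -/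
inductive IsConstructible (σ : AlgebraicAction S G) : Subgroup G → Prop
  | top : IsConstructible σ ⊤
  | map (s : S) {C : Subgroup G} :
      IsConstructible σ C → IsConstructible σ (C.map (σ.toHom s))
  | comap (s : S) {C : Subgroup G} :
      IsConstructible σ C → IsConstructible σ (C.comap (σ.toHom s))

/-- `X ∈ Idem σ` if `X` is the domain of an idempotent of `I`. An idempotent partial bijection is
the identity map of its domain, so that the semilattice `ℰ` of idempotents of `I`
is identified in this way with a family of subsets of `G`, with product the intersection. -/
def Idem (σ : AlgebraicAction S G) : Set (Set G) :=
  {X | ∃ φ : InvSgp σ, φ.mul φ = φ ∧ dom φ.1 = X}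

variable {σ : AlgebraicAction S G}

theorem mem_of_idem {φ : InvSgp σ} (h : φ.mul φ = φ) {a b : G} (hab : b ∈ φ.1 a) : a = b := by
  have h1 : φ.1.trans φ.1 = φ.1 := congrArg Subtype.val h
  have h2 : b ∈ (φ.1.trans φ.1) a := by rw [h1]; exact hab
  obtain ⟨c, hc, hcb⟩ := (PEquiv.mem_trans _ _ _ _).1 h2
  have : c = b := Option.mem_unique hc hab
  subst this
  exact φ.1.inj hab hcb

/-- For `φ ∈ I` and `X ∈ ℰ`, the domain of the idempotent `φ⁻¹ id_X φ` is `φ⁻¹(X)`. -/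
theorem preimage_mem_Idem (φ : InvSgp σ) {X : Set G} (hX : X ∈ Idem σ) :
    {g | ∃ h, h ∈ φ.1 g ∧ h ∈ X} ∈ Idem σ := by
  obtain ⟨ψ, hψ, rfl⟩ := hX
  have key : ∀ a b : G, b ∈ ((φ.inv.mul (ψ.mul φ)).1) a ↔
      a = b ∧ ∃ h, h ∈ φ.1 a ∧ h ∈ dom ψ.1 := by
    intro a b
    change b ∈ ((φ.1.trans ψ.1).trans φ.1.symm) a ↔ _
    simp only [PEquiv.mem_trans, PEquiv.mem_iff_mem]
    constructor
    · rintro ⟨c, ⟨d, hd, hc⟩, hb⟩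
      obtain rfl := mem_of_idem hψ hc
      exact ⟨φ.1.inj hd hb, d, hd, d, hc⟩
    · rintro ⟨rfl, h, hh, k, hk⟩
      obtain rfl := mem_of_idem hψ hk
      exact ⟨h, ⟨h, hh, hk⟩, hh⟩
  refine ⟨φ.inv.mul (ψ.mul φ), ?_, ?_⟩
  · apply Subtype.ext
    apply PEquiv.ext
    intro a
    ext b
    change b ∈ ((φ.inv.mul (ψ.mul φ)).1.trans (φ.inv.mul (ψ.mul φ)).1) a ↔
      b ∈ ((φ.inv.mul (ψ.mul φ)).1) a
    rw [PEquiv.mem_trans]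
    constructor
    · rintro ⟨c, hc, hb⟩
      obtain rfl := ((key _ _).1 hc).1
      exact hb
    · intro hb
      obtain rfl := ((key _ _).1 hb).1
      exact ⟨a, hb, hb⟩
  · ext a
    constructor
    · rintro ⟨b, hb⟩
      exact ((key _ _).1 hb).2
    · intro h
      exact ⟨a, (key _ _).2 ⟨rfl, h⟩⟩

theorem univ_mem_Idem : Set.univ ∈ Idem σ := by
  refine ⟨InvSgp.one, Subtype.ext (PEquiv.trans_refl _), ?_⟩
  ext a
  exact ⟨fun _ => trivial, fun _ => ⟨a, rfl⟩⟩

theorem dom_mem_Idem (φ : InvSgp σ) : dom φ.1 ∈ Idem σ := by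
  have h := preimage_mem_Idem φ (univ_mem_Idem (σ := σ))
  simpa [dom] using h

theorem inter_mem_Idem {X Y : Set G} (hX : X ∈ Idem σ) (hY : Y ∈ Idem σ) : X ∩ Y ∈ Idem σ := by
  obtain ⟨φ, hφ, rfl⟩ := hX
  convert preimage_mem_Idem φ hY using 1
  ext a
  constructor
  · rintro ⟨⟨b, hb⟩, ha⟩
    obtain rfl := mem_of_idem hφ hb
    exact ⟨a, hb, ha⟩
  · rintro ⟨b, hb, hbY⟩
    obtain rfl := mem_of_idem hφ hb
    exact ⟨⟨a, hb⟩, hbY⟩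

/-- The domain of `φ ∈ I`, as an element of `ℰ`. -/
def domE (φ : InvSgp σ) : Idem σ := ⟨dom φ.1, dom_mem_Idem φ⟩

/-- The preimage of `X ∈ ℰ` under `φ ∈ I`, as an element of `ℰ`. -/
def preE (φ : InvSgp σ) (X : Idem σ) : Idem σ :=
  ⟨{g | ∃ h, h ∈ φ.1 g ∧ h ∈ X.1}, preimage_mem_Idem φ X.2⟩

/-- The product in the semilattice `ℰ`. -/
def interE (X Y : Idem σ) : Idem σ := ⟨X.1 ∩ Y.1, inter_mem_Idem X.2 Y.2⟩

/-- The largest element `G` of `ℰ`. -/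
def topE : Idem σ := ⟨Set.univ, univ_mem_Idem⟩

/-! ### Characters and the boundary -/

/-- The space of characters of `ℰ`: nonzero multiplicative maps `ℰ → {0, 1}` that send `∅` to `0`,
with the topology of pointwise convergence (the subspace topology of the product
topology, where `{0, 1} = Bool` is discrete). -/
abbrev Character (σ : AlgebraicAction S G) : Type v :=
  {χ : Idem σ → Bool // (∃ X, χ X = true) ∧
    (∀ X Y, χ (interE X Y) = (χ X && χ Y)) ∧ ∀ X, X.1 = ∅ → χ X = false}

namespace Character

theorem inter (χ : Character σ) {X Y : Idem σ} :
    χ.1 (interE X Y) = true ↔ χ.1 X = true ∧ χ.1 Y = true := by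
  rw [χ.2.2.1, Bool.and_eq_true]

theorem mono (χ : Character σ) {X Y : Idem σ} (h : X.1 ⊆ Y.1) (hX : χ.1 X = true) :
    χ.1 Y = true := by
  have e : interE X Y = X := Subtype.ext (Set.inter_eq_left.2 h)
  rw [← e] at hX
  exact (χ.inter.1 hX).2

theorem top (χ : Character σ) : χ.1 topE = true := by
  obtain ⟨X, hX⟩ := χ.2.1
  exact χ.mono (Set.subset_univ _) hX

theorem nonempty (χ : Character σ) {X : Idem σ} (h : χ.1 X = true) : X.1.Nonempty := by
  rw [Set.nonempty_iff_ne_empty]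
  intro h0
  rw [χ.2.2.2 X h0] at h
  cases h

/-- The filter of elements of `ℰ` on which the character is `1`. -/
def filter (χ : Character σ) : Set (Idem σ) := {X | χ.1 X = true}

/-- The characters whose filter is maximal with respect to inclusion. -/
def IsMaximal (χ : Character σ) : Prop :=
  ∀ χ' : Character σ, χ.filter ⊆ χ'.filter → χ'.filter = χ.filter

end Character

/-- The boundary: the closure of the set of maximal characters in the space of characters. -/
def boundary (σ : AlgebraicAction S G) : Set (Character σ) :=
  closure {χ | χ.IsMaximal}

/-- The action of `I` on characters: `φ.χ = χ(φ⁻¹ ⊔ φ)`, defined if `χ(dom φ) = 1`. -/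
def act (φ : InvSgp σ) (χ : Character σ) (h : χ.1 (domE φ) = true) : Character σ :=
  ⟨fun X => χ.1 (preE φ X), by
    refine ⟨⟨topE, ?_⟩, ?_, ?_⟩
    · refine χ.mono ?_ h
      rintro g ⟨k, hk⟩
      exact ⟨k, hk, trivial⟩
    · intro X Y
      have e : preE φ (interE X Y) = interE (preE φ X) (preE φ Y) := by
        apply Subtype.ext
        ext g
        constructor
        · rintro ⟨k, hk, hX, hY⟩
          exact ⟨⟨k, hk, hX⟩, ⟨k, hk, hY⟩⟩
        · rintro ⟨⟨k, hk, hX⟩, ⟨l, hl, hY⟩⟩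
          obtain rfl := Option.mem_unique hk hl
          exact ⟨k, hk, hX, hY⟩
      exact (congrArg χ.1 e).trans (χ.2.2.1 _ _)
    · intro X hX
      apply χ.2.2.2
      ext g
      simp [preE, hX]⟩

/-! ### The transformation groupoid -/

/-- The pairs `(φ, χ)` with `φ ∈ I`, `χ` a character and `χ(dom φ) = 1`. -/
abbrev Pairs (σ : AlgebraicAction S G) : Type v :=
  {p : InvSgp σ × Character σ // p.2.1 (domE p.1) = true}

/-- Two pairs `(φ, χ)` and `(ψ, ω)` are equivalent if `χ = ω` and `φ`, `ψ` have the same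
restriction to some nonempty `X ∈ ℰ` with `χ(X) = 1`. -/
def pairsSetoid (σ : AlgebraicAction S G) : Setoid (Pairs σ) where
  r p q := p.1.2 = q.1.2 ∧ ∃ X : Idem σ, X.1.Nonempty ∧
    (∀ x ∈ X.1, p.1.1.1 x = q.1.1.1 x) ∧ p.1.2.1 X = true
  iseqv := by
    refine ⟨fun p => ⟨rfl, topE, ⟨1, trivial⟩, fun _ _ => rfl, p.1.2.top⟩, ?_, ?_⟩
    · rintro p q ⟨h, X, hX, hpq, hχ⟩
      exact ⟨h.symm, X, hX, fun x hx => (hpq x hx).symm, h ▸ hχ⟩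
    · rintro p q t ⟨h, X, -, hpq, hχ⟩ ⟨h', Y, -, hqt, hω⟩
      have hXY : p.1.2.1 (interE X Y) = true := p.1.2.inter.2 ⟨hχ, by rw [h]; exact hω⟩
      exact ⟨h.trans h', interE X Y, p.1.2.nonempty hXY,
        fun x hx => (hpq x hx.1).trans (hqt x hx.2), hXY⟩

/-- The transformation groupoid `I ⋉ ℰ^`, as a set of arrows `[φ, χ]`. -/
def TransfGroupoid (σ : AlgebraicAction S G) : Type v := Quotient (pairsSetoid σ)

namespace TransfGroupoid

/-- The class `[φ, χ]`. -/
def mk (φ : InvSgp σ) (χ : Character σ) (h : χ.1 (domE φ) = true) : TransfGroupoid σ :=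
  Quotient.mk (pairsSetoid σ) ⟨(φ, χ), h⟩

/-- The source map `[φ, χ] ↦ χ`. -/
def source : TransfGroupoid σ → Character σ :=
  Quotient.lift (fun p => p.1.2) (fun _ _ h => h.1)

/-- The range map `[φ, χ] ↦ φ.χ`. -/
def range : TransfGroupoid σ → Character σ :=
  Quotient.lift (fun p => act p.1.1 p.1.2 p.2) (by
    rintro ⟨⟨φ, χ⟩, hp⟩ ⟨⟨ψ, ω⟩, hq⟩ ⟨h, X, -, hX, hχ⟩
    dsimp only at h hX hχ hp hq
    subst h
    apply Subtype.ext
    funext Y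
    have aux : ∀ α β : InvSgp σ, (∀ x ∈ X.1, α.1 x = β.1 x) →
        χ.1 (preE α Y) = true → χ.1 (preE β Y) = true := by
      intro α β hαβ hα
      refine χ.mono ?_ (χ.inter.2 ⟨hχ, hα⟩)
      rintro g ⟨hg, k, hk, hkY⟩
      exact ⟨k, hαβ g hg ▸ hk, hkY⟩
    exact Bool.eq_iff_iff.2
      ⟨aux φ ψ hX, aux ψ φ (fun x hx => (hX x hx).symm)⟩)

/-- The cylinder sets `ℰ^(X; F)`: the characters that are `1` on `X` and `0` on the elements
of `F`. -/
def cylinder (X : Idem σ) (F : Set (Idem σ)) : Set (Character σ) :=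
  {χ | χ.1 X = true ∧ ∀ Y ∈ F, χ.1 Y = false}

/-- The topology with basis the sets `[φ, ℰ^(X; F)] = {[φ, χ] : χ ∈ ℰ^(X; F)}`, where `φ ∈ I`,
`X ∈ ℰ`, `F ⊆ ℰ` is finite, and `χ(dom φ) = 1` for all `χ ∈ ℰ^(X; F)`. -/
instance : TopologicalSpace (TransfGroupoid σ) :=
  TopologicalSpace.generateFrom
    {U | ∃ (φ : InvSgp σ) (X : Idem σ) (F : Set (Idem σ)), F.Finite ∧
      ∃ h : ∀ χ ∈ cylinder X F, χ.1 (domE φ) = true,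
        U = {γ | ∃ (χ : Character σ) (hχ : χ ∈ cylinder X F), γ = mk φ χ (h χ hχ)}}

theorem act_dom_inv (φ : InvSgp σ) (χ : Character σ) (h : χ.1 (domE φ) = true) :
    (act φ χ h).1 (domE φ.inv) = true := by
  refine χ.mono ?_ h
  rintro g ⟨k, hk⟩
  exact ⟨k, hk, g, φ.1.mem_iff_mem.2 hk⟩

theorem act_dom_mul (φ ψ : InvSgp σ) (χ : Character σ) (h : χ.1 (domE ψ) = true)
    (h' : (act ψ χ h).1 (domE φ) = true) : χ.1 (domE (φ.mul ψ)) = true := by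
  refine χ.mono ?_ h'
  rintro g ⟨k, hk, l, hl⟩
  exact ⟨l, (PEquiv.mem_trans _ _ _ _).2 ⟨k, hk, hl⟩⟩

/-- Inversion `[φ, χ]⁻¹ = [φ⁻¹, φ.χ]`. -/
def inv : TransfGroupoid σ → TransfGroupoid σ :=
  Quotient.lift (fun p => mk p.1.1.inv (act p.1.1 p.1.2 p.2) (act_dom_inv _ _ _)) (by
    rintro ⟨⟨φ, χ⟩, hp⟩ ⟨⟨ψ, ω⟩, hq⟩ hpq
    have hr : act φ χ hp = act ψ ω hq :=
      congrArg range (Quotient.sound (s := pairsSetoid σ) hpq)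
    obtain ⟨h, X, -, hX, hχ⟩ := hpq
    dsimp only at h hX hχ hp hq
    subst h
    have hD : χ.1 (preE φ (preE φ.inv (interE X (interE (domE φ) (domE ψ))))) = true := by
      refine χ.mono ?_ (χ.inter.2 ⟨hχ, χ.inter.2 ⟨hp, hq⟩⟩)
      rintro g ⟨hg, ⟨k, hk⟩, hg'⟩
      exact ⟨k, hk, g, φ.1.mem_iff_mem.2 hk, hg, ⟨k, hk⟩, hg'⟩
    refine Quotient.sound (s := pairsSetoid σ) ⟨hr,
      preE φ.inv (interE X (interE (domE φ) (domE ψ))), (act φ χ hp).nonempty hD, ?_, hD⟩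
    rintro x ⟨g, hg, hgX, -⟩
    change φ.1.symm x = ψ.1.symm x
    have h1 : x ∈ φ.1 g := φ.1.mem_iff_mem.1 hg
    have h2 : x ∈ ψ.1 g := hX g hgX ▸ h1
    exact (show φ.1.symm x = some g from hg).trans (ψ.1.mem_iff_mem.2 h2 : ψ.1.symm x = some g).symm)

/-- Multiplication `[φ, ψ.χ] [ψ, χ] = [φ ψ, χ]`, defined if the source of the first arrow is the
range of the second. -/
noncomputable def mul (a b : TransfGroupoid σ) (h : a.source = b.range) : TransfGroupoid σ :=
  mk (a.out.1.1.mul b.out.1.1) b.out.1.2 (by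
    have ha : a.source = a.out.1.2 := by
      conv_lhs => rw [← Quotient.out_eq a]
      rfl
    have hb : b.range = act b.out.1.1 b.out.1.2 b.out.2 := by
      conv_lhs => rw [← Quotient.out_eq b]
      rfl
    refine act_dom_mul _ _ _ b.out.2 ?_
    rw [← hb, ← h, ha]
    exact a.out.2)

/-- Multiplication does not depend on the choice of representatives. -/
theorem mk_mul_mk (φ ψ : InvSgp σ) (χ : Character σ) (hψ : χ.1 (domE ψ) = true)
    (hφ : (act ψ χ hψ).1 (domE φ) = true) :
    mul (mk φ (act ψ χ hψ) hφ) (mk ψ χ hψ) rfl =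
      mk (φ.mul ψ) χ (act_dom_mul φ ψ χ hψ hφ) := by
  obtain ⟨h1, X, -, hX, hχX⟩ := Quotient.mk_out (s := pairsSetoid σ)
    (⟨(φ, act ψ χ hψ), hφ⟩ : Pairs σ)
  obtain ⟨h2, Y, -, hY, hχY⟩ := Quotient.mk_out (s := pairsSetoid σ)
    (⟨(ψ, χ), hψ⟩ : Pairs σ)
  rw [h1] at hχX
  rw [h2] at hχY
  have hZ : χ.1 (interE (preE ψ X) Y) = true := χ.inter.2 ⟨hχX, hχY⟩
  refine Quotient.sound (s := pairsSetoid σ)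
    ⟨h2, interE (preE ψ X) Y, χ.nonempty hZ, ?_, h2 ▸ hZ⟩
  rintro x ⟨⟨k, hk, hkX⟩, hxY⟩
  have e1 := hX k hkX
  have e2 := hY x hxY
  have hk' : ψ.1 x = some k := hk
  change (PEquiv.trans _ _ : G ≃. G) x = (ψ.1.trans φ.1) x
  refine (congrArg (fun o => Option.bind o _) e2).trans ?_
  change Option.bind (ψ.1 x) _ = Option.bind (ψ.1 x) φ.1
  rw [hk']
  exact e1

end TransfGroupoid

/-- The groupoid of the action: the restriction of the transformation groupoid to the boundary,
with the subspace topology. -/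
def TightGroupoid (σ : AlgebraicAction S G) : Type v :=
  {γ : TransfGroupoid σ // γ.source ∈ boundary σ ∧ γ.range ∈ boundary σ}

instance : TopologicalSpace (TightGroupoid σ) := instTopologicalSpaceSubtype

/-! ### The finiteness condition -/

/-- The family of all constructible cosets contained in the fixed point set of `φ`, together with
the empty set. -/
def fixFamily (φ : InvSgp σ) : Set (Set G) :=
  {X | X ∈ Idem σ ∧ X ⊆ fixSet φ.1} ∪ {∅}

/-- Condition (H): for every `φ ∈ I`, there are finitely many (possibly zero) cosets
`g i • C i ⊆ fix φ`, with all `C i` constructible subgroups, whose union is the union of all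
constructible cosets that are contained in `fix φ`. -/
def ConditionH (σ : AlgebraicAction S G) : Prop :=
  ∀ φ : InvSgp σ, ∃ (n : ℕ) (g : Fin n → G) (C : Fin n → Subgroup G),
    (∀ i, IsConstructible σ (C i)) ∧
    (∀ i, g i • (C i : Set G) ⊆ fixSet φ.1) ∧
    ⋃₀ fixFamily φ = ⋃ i, g i • (C i : Set G)

end AlgAct

/-! Arrows `[φ, χ]` and `[ψ, χ]` are equal exactly when `χ` is `1` on a constructible coset
contained in `fix(ψ⁻¹φ)`. Since `source` is continuous into a Hausdorff space, only distinct arrows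
with a common source need separating.

Everything rests on `boundary_eq_closure_point`: the boundary is the closure of the point
characters, because a point outside a coset of `C` lies in another coset of `C`, disjoint from the
first. Hence a boundary character that is `1` on a set is `1` on some member of any finite cover of
it (`exists_eq_true_of_mem_boundary`).

Under (H), distinct arrows over `χ` force `χ` to vanish on the finitely many cosets that exhaust
`fix(ψ⁻¹φ)`. The slices of `φ` and `ψ` over characters vanishing there separate the arrows: a common
boundary arrow would contradict the covering property.

Conversely, over the compact set of boundary characters that are `1` on `dom φ`, the sections `[φ,
χ]` and `[1, χ]` are continuous. Hausdorffness makes their coincidence set closed, hence compact. It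
is covered by the open sets `χ(X) = 1` with `X ⊆ fix φ`, and a finite subcover, tested on point
characters, gives (H). -/

namespace AlgAct

open Set Topology

universe u v

variable {S : Type u} {G : Type v} [Monoid S] [Group G] {σ : AlgebraicAction S G}

/-! ### Constructible cosets -/

/-- A set is a constructible coset if it is a left coset of a constructible subgroup. -/
def IsConstructibleCoset (σ : AlgebraicAction S G) (X : Set G) : Prop :=
  ∃ (g : G) (C : Subgroup G), IsConstructible σ C ∧ X = g • (C : Set G)

theorem IsConstructibleCoset.of_mem {X : Set G} (hX : IsConstructibleCoset σ X) {g : G}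
    (hg : g ∈ X) : ∃ C : Subgroup G, IsConstructible σ C ∧ X = g • (C : Set G) := by
  obtain ⟨k, C, hC, rfl⟩ := hX
  refine ⟨C, hC, ?_⟩
  rw [mem_smul_set_iff_inv_smul_mem, smul_eq_mul, SetLike.mem_coe] at hg
  exact (leftCoset_eq_iff C).2 hg

theorem mem_endo {s : S} {a b : G} : b ∈ endo σ s a ↔ b = σ.toHom s a := by
  change some (σ.toHom s a) = some b ↔ _
  rw [Option.some_inj, eq_comm]

theorem mem_transl {g a b : G} : b ∈ transl g a ↔ b = g * a := by
  change some (g * a) = some b ↔ _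
  rw [Option.some_inj, eq_comm]

theorem mem_smul_coe_iff {g a : G} {C : Subgroup G} : a ∈ g • (C : Set G) ↔ g⁻¹ * a ∈ C := by
  rw [mem_smul_set_iff_inv_smul_mem, smul_eq_mul, SetLike.mem_coe]

theorem endo_preimage (s : S) (X : Set G) :
    {g | ∃ h, h ∈ endo σ s g ∧ h ∈ X} = σ.toHom s ⁻¹' X := by
  simp only [mem_endo, exists_eq_left]
  rfl

theorem endo_image (s : S) (X : Set G) :
    {h | ∃ g, h ∈ endo σ s g ∧ g ∈ X} = σ.toHom s '' X := by
  ext a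
  simp only [mem_endo]
  exact ⟨fun ⟨g, h, hg⟩ => ⟨g, hg, h.symm⟩, fun ⟨g, hg, h⟩ => ⟨g, h.symm, hg⟩⟩

theorem transl_preimage (k : G) (X : Set G) :
    {g | ∃ h, h ∈ transl k g ∧ h ∈ X} = k⁻¹ • X := by
  simp only [mem_transl, exists_eq_left]
  ext a
  rw [mem_smul_set_iff_inv_smul_mem, inv_inv]
  rfl

theorem transl_image (k : G) (X : Set G) :
    {h | ∃ g, h ∈ transl k g ∧ g ∈ X} = k • X := by
  ext a
  simp only [mem_transl]
  exact ⟨fun ⟨g, h, hg⟩ => ⟨g, hg, h.symm⟩, fun ⟨g, hg, h⟩ => ⟨g, h.symm, hg⟩⟩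

theorem preimage_smul_coe (f : G →* G) (k : G) (C : Subgroup G) :
    f ⁻¹' (f k • (C : Set G)) = k • (C.comap f : Set G) := by
  ext a
  rw [mem_preimage, mem_smul_coe_iff, mem_smul_coe_iff, Subgroup.mem_comap, map_mul, map_inv]

/-- Images and preimages of constructible cosets under elements of `I` are constructible cosets,
unless they are empty. -/
theorem isConstructibleCoset_image_preimage {φ : G ≃. G} (hφ : IsGen σ φ) {X : Set G}
    (hX : X = ∅ ∨ IsConstructibleCoset σ X) :
    ({g | ∃ h, h ∈ φ g ∧ h ∈ X} = ∅ ∨ IsConstructibleCoset σ {g | ∃ h, h ∈ φ g ∧ h ∈ X}) ∧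
    ({h | ∃ g, h ∈ φ g ∧ g ∈ X} = ∅ ∨ IsConstructibleCoset σ {h | ∃ g, h ∈ φ g ∧ g ∈ X}) := by
  induction hφ generalizing X with
  | endo s =>
    rcases hX with rfl | hX
    · simp
    constructor
    · rw [endo_preimage, or_iff_not_imp_left, ← ne_eq, ← nonempty_iff_ne_empty]
      rintro ⟨k, hk⟩
      -- A point `k` of the preimage lets `σ s k` serve as representative of the coset.
      obtain ⟨C, hC, rfl⟩ := hX.of_mem hk
      exact ⟨k, _, hC.comap s, preimage_smul_coe (σ.toHom s) k C⟩
    · obtain ⟨g, C, hC, rfl⟩ := hX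
      refine .inr ⟨σ.toHom s g, _, hC.map s, ?_⟩
      rw [endo_image]
      exact image_smul_distrib (σ.toHom s) g (C : Set G)
  | transl k =>
    rw [transl_preimage, transl_image]
    rcases hX with rfl | ⟨g, C, hC, rfl⟩
    · simp
    · rw [smul_smul, smul_smul]
      exact ⟨.inr ⟨_, C, hC, rfl⟩, .inr ⟨_, C, hC, rfl⟩⟩
  | @comp φ ψ _ _ hφ hψ =>
    constructor
    · have e : {g | ∃ h, h ∈ (φ.trans ψ) g ∧ h ∈ X} =
          {g | ∃ h, h ∈ φ g ∧ h ∈ {g | ∃ h, h ∈ ψ g ∧ h ∈ X}} := by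
        ext a
        simp only [PEquiv.mem_trans, mem_ofPred_eq]
        exact ⟨fun ⟨c, ⟨b, hb, hc⟩, hX⟩ => ⟨b, hb, c, hc, hX⟩,
          fun ⟨b, hb, c, hc, hX⟩ => ⟨c, ⟨b, hb, hc⟩, hX⟩⟩
      rw [e]
      exact (hφ (hψ hX).1).1
    · have e : {h | ∃ g, h ∈ (φ.trans ψ) g ∧ g ∈ X} =
          {h | ∃ g, h ∈ ψ g ∧ g ∈ {h | ∃ g, h ∈ φ g ∧ g ∈ X}} := by
        ext a
        simp only [PEquiv.mem_trans, mem_ofPred_eq]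
        exact ⟨fun ⟨c, ⟨b, hb, hc⟩, hX⟩ => ⟨b, hc, c, hb, hX⟩,
          fun ⟨b, hc, c, hb, hX⟩ => ⟨c, ⟨b, hb, hc⟩, hX⟩⟩
      rw [e]
      exact (hψ (hφ hX).2).2
  -- Inversion swaps images and preimages, so the induction has to carry both.
  | inv _ h =>
    simp only [PEquiv.mem_iff_mem]
    exact (h hX).symm

theorem isConstructibleCoset_of_mem_Idem {X : Set G} (hX : X ∈ Idem σ) (hne : X.Nonempty) :
    IsConstructibleCoset σ X := by
  obtain ⟨φ, -, rfl⟩ := hX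
  have h := (isConstructibleCoset_image_preimage (σ := σ) φ.2 (X := univ)
    (.inr ⟨1, ⊤, .top, by simp⟩)).1
  simp only [mem_univ, and_true] at h
  exact h.resolve_left hne.ne_empty

theorem coe_mem_Idem {C : Subgroup G} (hC : IsConstructible σ C) : (C : Set G) ∈ Idem σ := by
  induction hC with
  | top => exact univ_mem_Idem
  | map s _ ih =>
    have h := preimage_mem_Idem (InvSgp.inv ⟨endo σ s, .endo s⟩) ih
    simp only [InvSgp.inv, PEquiv.mem_iff_mem] at h
    rwa [endo_image] at h
  | comap s _ ih =>
    have h := preimage_mem_Idem ⟨endo σ s, .endo s⟩ ih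
    rwa [endo_preimage] at h

theorem smul_mem_Idem (g : G) {C : Subgroup G} (hC : IsConstructible σ C) :
    g • (C : Set G) ∈ Idem σ := by
  have h := preimage_mem_Idem ⟨transl g⁻¹, .transl _⟩ (coe_mem_Idem hC)
  rwa [transl_preimage, inv_inv] at h

/-- A point outside a constructible coset lies in a constructible coset disjoint from it. -/
theorem exists_mem_disjoint {X : Set G} (hX : X ∈ Idem σ) {g : G} (hg : g ∉ X) :
    ∃ Z : Idem σ, g ∈ Z.1 ∧ Disjoint Z.1 X := by
  rcases X.eq_empty_or_nonempty with rfl | hne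
  · exact ⟨topE, mem_univ _, disjoint_empty _⟩
  obtain ⟨k, C, hC, rfl⟩ := isConstructibleCoset_of_mem_Idem hX hne
  -- The witness is `gC`: distinct left cosets of the same subgroup are disjoint.
  refine ⟨⟨_, smul_mem_Idem g hC⟩, ⟨1, C.one_mem, by simp⟩, ?_⟩
  rw [Set.disjoint_left]
  rintro _ ⟨c, hc, rfl⟩ h
  dsimp only at h
  rw [mem_smul_coe_iff, smul_eq_mul, ← mul_assoc, C.mul_mem_cancel_right hc] at h
  exact hg (mem_smul_coe_iff.2 h)

/-! ### The topology of the space of characters -/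

namespace Character

theorem exists_lower_bound (χ : Character σ) {s : Set (Idem σ)} (hs : s.Finite)
    (h : ∀ Y ∈ s, χ.1 Y = true) : ∃ X, χ.1 X = true ∧ ∀ Y ∈ s, X.1 ⊆ Y.1 := by
  induction s, hs using Set.Finite.induction_on with
  | empty => exact ⟨topE, χ.top, by simp⟩
  | @insert Y s _ _ ih =>
    obtain ⟨X, hX, hXs⟩ := ih fun Z hZ => h Z (mem_insert_of_mem _ hZ)
    refine ⟨interE Y X, χ.inter.2 ⟨h Y (mem_insert _ _), hX⟩, ?_⟩
    rintro Z (rfl | hZ)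
    · exact inter_subset_left
    · exact inter_subset_right.trans (hXs Z hZ)

theorem continuous_eval (X : Idem σ) : Continuous fun χ : Character σ => χ.1 X :=
  (continuous_apply X).comp continuous_subtype_val

theorem isClopen_eval (X : Idem σ) (b : Bool) : IsClopen {χ : Character σ | χ.1 X = b} :=
  (isClopen_discrete {b}).preimage (continuous_eval X)

theorem isOpen_cylinder (X : Idem σ) {F : Set (Idem σ)} (hF : F.Finite) :
    IsOpen (TransfGroupoid.cylinder X F) := by
  have h : TransfGroupoid.cylinder X F =
      {χ | χ.1 X = true} ∩ ⋂ Y ∈ F, {χ | χ.1 Y = false} := by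
    ext
    simp [TransfGroupoid.cylinder]
  rw [h]
  exact (isClopen_eval X true).isOpen.inter
    (hF.isOpen_biInter fun Y _ => (isClopen_eval Y false).isOpen)

/-- A basic open set prescribes finitely many values. By monotonicity, the values `1` are all forced
by a single lower bound `X` on which `χ` is `1`. -/
theorem exists_cylinder_subset {O : Set (Character σ)} (hO : IsOpen O) {χ : Character σ}
    (hχ : χ ∈ O) : ∃ (X : Idem σ) (F : Set (Idem σ)), F.Finite ∧
      χ ∈ TransfGroupoid.cylinder X F ∧ TransfGroupoid.cylinder X F ⊆ O := by
  obtain ⟨V, hV, rfl⟩ := isOpen_induced_iff.1 hO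
  obtain ⟨I, w, hw, hIV⟩ := isOpen_pi_iff.1 hV χ.1 hχ
  obtain ⟨X, hX, hXI⟩ := χ.exists_lower_bound (s := {Y | Y ∈ I ∧ χ.1 Y = true})
    (I.finite_toSet.subset fun _ h => h.1) fun _ h => h.2
  refine ⟨X, {Y | Y ∈ I ∧ χ.1 Y = false}, I.finite_toSet.subset fun _ h => h.1,
    ⟨hX, fun _ h => h.2⟩, fun ω hω => hIV fun Y hY => ?_⟩
  have hY' : ω.1 Y = χ.1 Y := by
    cases h : χ.1 Y with
    | true => exact ω.mono (hXI Y ⟨hY, h⟩) hω.1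
    | false => exact hω.2 Y ⟨hY, h⟩
  rw [hY']
  exact (hw Y hY).2

theorem mem_closure_iff_cylinder {A : Set (Character σ)} {χ : Character σ} :
    χ ∈ closure A ↔ ∀ (X : Idem σ) (F : Set (Idem σ)), F.Finite →
      χ ∈ TransfGroupoid.cylinder X F → (TransfGroupoid.cylinder X F ∩ A).Nonempty := by
  rw [mem_closure_iff]
  constructor
  · exact fun h X F hF hχ => h _ (isOpen_cylinder X hF) hχ
  · intro h O hO hχ
    obtain ⟨X, F, hF, hχF, hsub⟩ := exists_cylinder_subset hO hχ
    exact (h X F hF hχF).mono (inter_subset_inter_left _ hsub)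

instance : CompactSpace (Character σ) := by
  suffices h : IsClosed {χ : Idem σ → Bool | (∃ X, χ X = true) ∧
      (∀ X Y, χ (interE X Y) = (χ X && χ Y)) ∧ ∀ X, X.1 = ∅ → χ X = false} from
    isCompact_iff_compactSpace.1 h.isCompact
  -- Being nonzero is not visibly a closed condition; it is replaced by the equivalent `χ(G) = 1`.
  have key : {χ : Idem σ → Bool | (∃ X, χ X = true) ∧
      (∀ X Y, χ (interE X Y) = (χ X && χ Y)) ∧ ∀ X, X.1 = ∅ → χ X = false} =
      {χ : Idem σ → Bool | χ topE = true} ∩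
      ((⋂ X, ⋂ Y, {χ | χ (interE X Y) = (χ X && χ Y)}) ∩
        ⋂ X, ⋂ _ : X.1 = ∅, {χ | χ X = false}) := by
    ext χ
    simp only [mem_ofPred_eq, mem_inter_iff, mem_iInter]
    exact ⟨fun h => ⟨Character.top ⟨χ, h⟩, h.2⟩, fun h => ⟨⟨_, h.1⟩, h.2⟩⟩
  rw [key]
  refine (isClosed_eq (continuous_apply _) continuous_const).inter (.inter ?_ ?_)
  · refine isClosed_iInter fun X => isClosed_iInter fun Y => isClosed_eq (continuous_apply _) ?_
    have hand : Continuous fun p : Bool × Bool => p.1 && p.2 := continuous_of_discreteTopology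
    have heval : ∀ Z : Idem σ, Continuous fun χ : Idem σ → Bool => χ Z := continuous_apply
    exact hand.comp ((heval X).prodMk (heval Y))
  · exact isClosed_iInter fun X => isClosed_iInter fun _ =>
      isClosed_eq (continuous_apply _) continuous_const

/-! ### Point characters and the boundary -/

open Classical in
/-- The character of all constructible cosets that contain a given point. -/
noncomputable def point (σ : AlgebraicAction S G) (g : G) : Character σ :=
  ⟨fun X => decide (g ∈ X.1), ⟨topE, by simp [topE]⟩, fun X Y => by
    simp [interE], fun X hX => by simp [hX]⟩

theorem point_eq_true {g : G} {X : Idem σ} : (point σ g).1 X = true ↔ g ∈ X.1 := by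
  simp [point]

theorem point_eq_false {g : G} {X : Idem σ} : (point σ g).1 X = false ↔ g ∉ X.1 := by
  simp [point]

theorem exists_isMaximal (χ : Character σ) :
    ∃ ω : Character σ, ω.IsMaximal ∧ χ.filter ⊆ ω.filter := by
  classical
  obtain ⟨M, hχM, hM⟩ := zorn_subset_nonempty (range (filter : Character σ → Set (Idem σ))) (by
    intro c hc hchain hne
    -- Any two members of the union already lie in one filter of the chain, so the union is again a
    -- filter.
    have hdir : ∀ X ∈ ⋃₀ c, ∀ Y ∈ ⋃₀ c, ∃ ω : Character σ, ω.filter ∈ c ∧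
        X ∈ ω.filter ∧ Y ∈ ω.filter := by
      rintro X ⟨a, ha, hX⟩ Y ⟨b, hb, hY⟩
      rcases hchain.total ha hb with h | h
      · obtain ⟨ω, rfl⟩ := hc hb
        exact ⟨ω, hb, h hX, hY⟩
      · obtain ⟨ω, rfl⟩ := hc ha
        exact ⟨ω, ha, hX, h hY⟩
    refine ⟨⋃₀ c, ⟨⟨fun X => decide (X ∈ ⋃₀ c), ?_, ?_, ?_⟩, ?_⟩, fun s hs =>
      subset_sUnion_of_mem hs⟩
    · obtain ⟨a, ha⟩ := hne
      obtain ⟨ω, rfl⟩ := hc ha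
      exact ⟨topE, decide_eq_true ⟨_, ha, ω.top⟩⟩
    · intro X Y
      rw [Bool.eq_iff_iff, Bool.and_eq_true, decide_eq_true_iff, decide_eq_true_iff,
        decide_eq_true_iff]
      constructor
      · rintro ⟨a, ha, h⟩
        obtain ⟨ω, rfl⟩ := hc ha
        exact ⟨⟨_, ha, (ω.inter.1 h).1⟩, ⟨_, ha, (ω.inter.1 h).2⟩⟩
      · rintro ⟨hX, hY⟩
        obtain ⟨ω, hω, h1, h2⟩ := hdir X hX Y hY
        exact ⟨_, hω, ω.inter.2 ⟨h1, h2⟩⟩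
    · intro X hX
      rw [decide_eq_false_iff_not]
      rintro ⟨a, ha, h⟩
      obtain ⟨ω, rfl⟩ := hc ha
      exact (ω.nonempty h).ne_empty hX
    · ext X
      exact decide_eq_true_iff) χ.filter ⟨χ, rfl⟩
  obtain ⟨ω, rfl⟩ := hM.prop
  exact ⟨ω, fun χ' h => (hM.le_of_ge ⟨χ', rfl⟩ h).antisymm h, hχM⟩

/-- A maximal filter contains every constructible coset that meets all of its elements. -/
theorem IsMaximal.eq_true {χ : Character σ} (hχ : χ.IsMaximal) {Y : Idem σ}
    (hY : ∀ X, χ.1 X = true → (X.1 ∩ Y.1).Nonempty) : χ.1 Y = true := by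
  classical
  -- `ω` is the character of the filter generated by `Y` and the filter of `χ`; maximality forces it
  -- to add nothing.
  let ω : Character σ := ⟨fun Z => decide (∃ X, χ.1 X = true ∧ X.1 ∩ Y.1 ⊆ Z.1),
    ⟨topE, decide_eq_true ⟨topE, χ.top, subset_univ _⟩⟩, fun Z W => by
      rw [Bool.eq_iff_iff, Bool.and_eq_true, decide_eq_true_iff, decide_eq_true_iff,
        decide_eq_true_iff]
      constructor
      · rintro ⟨X, hX, h⟩
        exact ⟨⟨X, hX, h.trans inter_subset_left⟩, ⟨X, hX, h.trans inter_subset_right⟩⟩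
      · rintro ⟨⟨X, hX, h⟩, ⟨X', hX', h'⟩⟩
        exact ⟨interE X X', χ.inter.2 ⟨hX, hX'⟩, fun a ha =>
          ⟨h ⟨ha.1.1, ha.2⟩, h' ⟨ha.1.2, ha.2⟩⟩⟩, fun Z hZ => by
      rw [decide_eq_false_iff_not]
      rintro ⟨X, hX, h⟩
      exact ((hY X hX).mono h).ne_empty hZ⟩
  have h := hχ ω fun Z hZ => decide_eq_true ⟨Z, hZ, inter_subset_left⟩
  have hYω : Y ∈ ω.filter := decide_eq_true ⟨topE, χ.top, inter_subset_right⟩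
  rw [h] at hYω
  exact hYω

end Character

open Character

/-- The boundary is the closure of the set of point characters. -/
theorem boundary_eq_closure_point :
    boundary σ = closure (range (Character.point σ)) := by
  apply Subset.antisymm
  · refine closure_minimal (fun χ hχ => ?_) isClosed_closure
    rw [mem_closure_iff_cylinder]
    rintro X F hF ⟨hX, hχF⟩
    -- By maximality, each `Y` outside the filter is disjoint from some member `Z` of it. Any point
    -- of `X` lying in all these `Z` gives a point character in the cylinder.
    have h : ∀ Y ∈ F, ∃ Z, χ.1 Z = true ∧ Disjoint Z.1 Y.1 := by
      intro Y hY
      by_contra! hcon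
      have := IsMaximal.eq_true hχ fun Z hZ => not_disjoint_iff_nonempty_inter.1 (hcon Z hZ)
      rw [hχF Y hY] at this
      cases this
    choose! Z hZ hZY using h
    obtain ⟨W, hW, hWZ⟩ := χ.exists_lower_bound (hF.image Z) (by
      rintro _ ⟨Y, hY, rfl⟩
      exact hZ Y hY)
    obtain ⟨g, hgX, hgW⟩ := χ.nonempty (χ.inter.2 ⟨hX, hW⟩)
    refine ⟨point σ g, ⟨point_eq_true.2 hgX, fun Y hY => point_eq_false.2 ?_⟩, g, rfl⟩
    exact disjoint_left.1 (hZY Y hY) (hWZ _ (mem_image_of_mem Z hY) hgW)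
  · refine closure_minimal ?_ isClosed_closure
    rintro _ ⟨g, rfl⟩
    rw [boundary, mem_closure_iff_cylinder]
    rintro X F hF ⟨hX, hF'⟩
    have h : ∀ Y ∈ F, ∃ Z : Idem σ, g ∈ Z.1 ∧ Disjoint Z.1 Y.1 :=
      fun Y hY => exists_mem_disjoint Y.2 (point_eq_false.1 (hF' Y hY))
    choose! Z hZ hZY using h
    -- A maximal filter above that of the point still contains each `Z Y`, hence excludes each `Y ∈
    -- F`.
    obtain ⟨ω, hω, hsub⟩ := (point σ g).exists_isMaximal
    refine ⟨ω, ⟨hsub hX, fun Y hY => ?_⟩, hω⟩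
    rw [← Bool.not_eq_true]
    intro hYω
    obtain ⟨a, ha, ha'⟩ := ω.nonempty (ω.inter.2 ⟨hsub (point_eq_true.2 (hZ Y hY)), hYω⟩)
    exact disjoint_left.1 (hZY Y hY) ha ha'

theorem point_mem_boundary (g : G) : Character.point σ g ∈ boundary σ := by
  rw [boundary_eq_closure_point]
  exact subset_closure ⟨g, rfl⟩

/-- A boundary character that takes the value `1` on a set takes the value `1` on one of the
members of any finite cover of this set. -/
theorem exists_eq_true_of_mem_boundary {χ : Character σ} (hχ : χ ∈ boundary σ) {X : Idem σ}
    {F : Set (Idem σ)} (hF : F.Finite) (hX : χ.1 X = true) (hXF : X.1 ⊆ ⋃ Y ∈ F, Y.1) :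
    ∃ Y ∈ F, χ.1 Y = true := by
  by_contra! hcon
  -- Otherwise the cylinder of `X` and `F` would contain a point character, whose point lies in `X`
  -- but in no member of `F`.
  rw [boundary_eq_closure_point, mem_closure_iff_cylinder] at hχ
  obtain ⟨_, ⟨hgX, hgF⟩, g, rfl⟩ := hχ X F hF ⟨hX, fun Y hY => by simpa using hcon Y hY⟩
  obtain ⟨Y, hY, hgY⟩ := mem_iUnion₂.1 (hXF (point_eq_true.1 hgX))
  exact point_eq_false.1 (hgF Y hY) hgY

/-- The action sends the point character of `g` to that of `φ(g)`. Thus `[φ, χ]` stays in the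
restricted groupoid as soon as `χ` is in the boundary. -/
theorem act_mem_boundary (φ : InvSgp σ) {χ : Character σ} (hχ : χ ∈ boundary σ)
    (h : χ.1 (domE φ) = true) : act φ χ h ∈ boundary σ := by
  rw [boundary_eq_closure_point, mem_closure_iff_cylinder] at hχ ⊢
  rintro X F hF ⟨hX, hXF⟩
  obtain ⟨_, ⟨hgX, hgF⟩, g, rfl⟩ := hχ (preE φ X) (preE φ '' F) (hF.image _) ⟨hX, by
    rintro _ ⟨Y, hY, rfl⟩
    exact hXF Y hY⟩
  obtain ⟨k, hk, hkX⟩ := point_eq_true.1 hgX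
  refine ⟨point σ k, ⟨point_eq_true.2 hkX, fun Y hY => point_eq_false.2 fun hkY => ?_⟩, k, rfl⟩
  exact point_eq_false.1 (hgF _ (mem_image_of_mem _ hY)) ⟨k, hk, hkY⟩

/-! ### The topology of the groupoid -/

namespace TransfGroupoid

theorem mk_eq_mk_iff {φ ψ : InvSgp σ} {χ ω : Character σ} {h : χ.1 (domE φ) = true}
    {h' : ω.1 (domE ψ) = true} : mk φ χ h = mk ψ ω h' ↔
      χ = ω ∧ ∃ X : Idem σ, (∀ x ∈ X.1, φ.1 x = ψ.1 x) ∧ χ.1 X = true := by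
  refine Quotient.eq.trans ⟨?_, ?_⟩
  · rintro ⟨e, X, -, hX⟩
    exact ⟨e, X, hX⟩
  · rintro ⟨e, X, hX⟩
    exact ⟨e, X, χ.nonempty hX.2, hX⟩

theorem exists_eq_mk (γ : TransfGroupoid σ) :
    ∃ (φ : InvSgp σ) (h : γ.source.1 (domE φ) = true), γ = mk φ γ.source h := by
  obtain ⟨⟨⟨φ, χ⟩, h⟩, rfl⟩ := Quotient.exists_rep γ
  exact ⟨φ, h, rfl⟩

theorem isOpen_slice (φ : InvSgp σ) (X : Idem σ) {F : Set (Idem σ)} (hF : F.Finite)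
    (hX : X.1 ⊆ dom φ.1) :
    IsOpen {γ : TransfGroupoid σ | ∃ (χ : Character σ) (hχ : χ ∈ cylinder X F),
      γ = mk φ χ (χ.mono (Y := domE φ) hX hχ.1)} :=
  TopologicalSpace.isOpen_generateFrom_of_mem ⟨φ, X, F, hF, fun χ hχ => χ.mono hX hχ.1, rfl⟩

theorem continuous_source : Continuous (source : TransfGroupoid σ → Character σ) := by
  rw [continuous_def]
  intro O hO
  rw [isOpen_iff_forall_mem_open]
  intro γ hγ
  obtain ⟨φ, h, hγφ⟩ := γ.exists_eq_mk
  obtain ⟨X, F, hF, hχ, hsub⟩ := exists_cylinder_subset hO hγ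
  refine ⟨_, ?_, isOpen_slice φ (interE X (domE φ)) hF inter_subset_right,
    ⟨γ.source, ⟨γ.source.inter.2 ⟨hχ.1, h⟩, hχ.2⟩, hγφ⟩⟩
  rintro _ ⟨ω, hω, rfl⟩
  exact hsub ⟨(ω.inter.1 hω.1).1, hω.2⟩

/-- A set `Y` witnessing that `φ` and `ψ` have the same germ at `χ` witnesses it for every character
in the open set where `Y` has value `1`. -/
theorem continuous_mk (φ : InvSgp σ) :
    Continuous fun χ : {χ : Character σ // χ.1 (domE φ) = true} => mk φ χ.1 χ.2 := by
  refine continuous_generateFrom_iff.2 ?_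
  rintro _ ⟨ψ, X, F, hF, h, rfl⟩
  rw [isOpen_iff_forall_mem_open]
  rintro ⟨χ, hφ⟩ ⟨ω, hω, e⟩
  obtain ⟨rfl, Y, hY, hχY⟩ := mk_eq_mk_iff.1 e
  refine ⟨Subtype.val ⁻¹' (cylinder X F ∩ {χ | χ.1 Y = true}), ?_,
    ((isOpen_cylinder X hF).inter (isClopen_eval Y true).isOpen).preimage continuous_subtype_val,
    ⟨hω, hχY⟩⟩
  rintro ⟨ω, hω⟩ ⟨hω', hωY⟩
  exact ⟨ω, hω', mk_eq_mk_iff.2 ⟨rfl, Y, hY, hωY⟩⟩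

end TransfGroupoid

/-! ### Hausdorffness and condition (H) -/

open TransfGroupoid

/-- The fixed points of `ψ⁻¹φ` are the points where `φ` and `ψ` are defined and agree. -/
theorem mem_fixSet_inv_mul {φ ψ : InvSgp σ} {x : G} :
    x ∈ fixSet (ψ.inv.mul φ).1 ↔ x ∈ dom φ.1 ∧ φ.1 x = ψ.1 x := by
  change x ∈ (φ.1.trans ψ.1.symm) x ↔ _
  rw [PEquiv.mem_trans]
  simp only [PEquiv.mem_iff_mem]
  constructor
  · rintro ⟨y, hy, hy'⟩
    exact ⟨⟨y, hy⟩, (Option.mem_def.1 hy).trans (Option.mem_def.1 hy').symm⟩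
  · rintro ⟨⟨y, hy⟩, e⟩
    exact ⟨y, hy, e ▸ hy⟩

theorem t2Space_of_conditionH (H : ConditionH σ) : T2Space (TightGroupoid σ) := by
  refine ⟨fun γ δ hne => ?_⟩
  have hsource : Continuous fun γ : TightGroupoid σ => γ.1.source :=
    continuous_source.comp continuous_subtype_val
  by_cases hs : γ.1.source = δ.1.source
  swap
  · obtain ⟨U, V, hU, hV, hγ, hδ, hUV⟩ := t2_separation hs
    exact ⟨_, _, hU.preimage hsource, hV.preimage hsource, hγ, hδ, hUV.preimage _⟩
  obtain ⟨φ, hφ, hγ⟩ := γ.1.exists_eq_mk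
  obtain ⟨ψ, hψ, hδ⟩ := δ.1.exists_eq_mk
  obtain ⟨n, g, C, hC, hsub, hunion⟩ := H (ψ.inv.mul φ)
  let F : Set (Idem σ) := range fun i => ⟨_, smul_mem_Idem (g i) (hC i)⟩
  have hF : F.Finite := finite_range _
  have hne' : γ.1 ≠ δ.1 := fun h => hne (Subtype.ext h)
  -- On each coset in `F` the maps `φ` and `ψ` agree, so value `1` there would identify the two
  -- arrows.
  have hγF : ∀ Y ∈ F, γ.1.source.1 Y = false := by
    rintro _ ⟨i, rfl⟩
    rw [← Bool.not_eq_true]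
    intro hY
    rw [hγ, hδ] at hne'
    exact hne' (mk_eq_mk_iff.2 ⟨hs, _, fun x hx => (mem_fixSet_inv_mul.1 (hsub i hx)).2, hY⟩)
  let D : Idem σ := interE (domE φ) (domE ψ)
  refine ⟨_, _, (isOpen_slice φ D hF inter_subset_left).preimage continuous_subtype_val,
    (isOpen_slice ψ D hF inter_subset_right).preimage continuous_subtype_val,
    ⟨_, ⟨γ.1.source.inter.2 ⟨hφ, hs ▸ hψ⟩, hγF⟩, hγ⟩,
    ⟨_, ⟨δ.1.source.inter.2 ⟨hs ▸ hφ, hψ⟩, hs ▸ hγF⟩, hδ⟩, ?_⟩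
  refine Set.disjoint_left.2 ?_
  rintro ε ⟨ω, hω, hε⟩ ⟨ω', hω', hε'⟩
  obtain ⟨rfl, X, hX, hωX⟩ := mk_eq_mk_iff.1 (hε.symm.trans hε')
  have hωb : ω ∈ boundary σ := by
    have := ε.2.1
    rwa [hε] at this
  -- On `X ∩ D` the two maps are defined and agree, so it is one of the constructible sets that (H)
  -- covers by `F`.
  have hfix : (interE X D).1 ⊆ ⋃ Y ∈ F, Y.1 := by
    have h1 : (interE X D).1 ⊆ ⋃₀ fixFamily (ψ.inv.mul φ) :=
      subset_sUnion_of_mem (.inl ⟨(interE X D).2, fun x hx =>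
        mem_fixSet_inv_mul.2 ⟨hx.2.1, hX x hx.1⟩⟩)
    rw [hunion] at h1
    refine h1.trans (iUnion_subset fun i => ?_)
    exact subset_biUnion_of_mem (s := F) (u := fun Y : Idem σ => Y.1)
      (mem_range_self (f := fun i => (⟨_, smul_mem_Idem (g i) (hC i)⟩ : Idem σ)) i)
  obtain ⟨Y, hY, hωY⟩ :=
    exists_eq_true_of_mem_boundary hωb hF (ω.inter.2 ⟨hωX, hω.1⟩) hfix
  rw [hω.2 Y hY] at hωY
  cases hωY

theorem mem_one {x y : G} : y ∈ (InvSgp.one (σ := σ)).1 x ↔ x = y :=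
  Option.some_inj

theorem conditionH_of_t2Space [T2Space (TightGroupoid σ)] : ConditionH σ := by
  intro φ
  let K : Set (Character σ) := boundary σ ∩ {χ | χ.1 (domE φ) = true}
  have hK : CompactSpace K := isCompact_iff_compactSpace.1
    (isClosed_closure.inter (isClopen_eval _ true).isClosed).isCompact
  have hone : ∀ χ : Character σ, χ.1 (domE InvSgp.one) = true := fun χ =>
    χ.mono (X := topE) (fun x _ => ⟨x, mem_one.2 rfl⟩) χ.top
  -- The section `χ ↦ [ψ, χ]` over `K`, to be used for `φ` and for the identity.
  let sec (ψ : InvSgp σ) (h : ∀ χ : K, χ.1.1 (domE ψ) = true) (χ : K) : TightGroupoid σ :=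
    ⟨mk ψ χ.1 (h χ), χ.2.1, act_mem_boundary ψ χ.2.1 (h χ)⟩
  have hsec : ∀ ψ h, Continuous (sec ψ h) := fun ψ h =>
    ((continuous_mk ψ).comp (continuous_subtype_val.subtype_mk h)).subtype_mk _
  have hclosed : IsClosed {χ : K | sec φ (fun χ => χ.2.2) χ = sec .one (fun χ => hone χ) χ} :=
    isClosed_eq (hsec _ _) (hsec _ _)
  obtain ⟨t, ht⟩ := hclosed.isCompact.elim_finite_subcover
    (fun X : {X : Idem σ // X.1 ⊆ fixSet φ.1} => {χ : K | χ.1.1 X.1 = true})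
    (fun X => (isClopen_eval X.1 true).isOpen.preimage continuous_subtype_val) (by
      intro χ hχ
      obtain ⟨-, X, hX, hχX⟩ := mk_eq_mk_iff.1 (congrArg Subtype.val hχ)
      refine mem_iUnion.2 ⟨⟨X, fun x hx => ?_⟩, hχX⟩
      change x ∈ φ.1 x
      rw [hX x hx]
      exact mem_one.2 rfl)
  classical
  -- Empty members of the subcover are discarded, since they are not cosets.
  let T : Type _ := {X : {X : Idem σ // X.1 ⊆ fixSet φ.1} // X ∈ t ∧ X.1.1.Nonempty}
  have : Finite T := (t.finite_toSet.subset (t := {X | X ∈ t ∧ X.1.1.Nonempty})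
    fun _ h => h.1).to_subtype
  obtain ⟨n, ⟨e⟩⟩ := Finite.exists_equiv_fin T
  have hcos : ∀ X : T, IsConstructibleCoset σ X.1.1.1 := fun X =>
    isConstructibleCoset_of_mem_Idem X.1.1.2 X.2.2
  choose g C hC hgC using hcos
  refine ⟨n, fun i => g (e.symm i), fun i => C (e.symm i), fun i => hC _, fun i => ?_, ?_⟩
  · rw [← hgC]
    exact (e.symm i).1.2
  apply Subset.antisymm
  · rintro x ⟨X, ⟨hX, hXφ⟩ | rfl, hx⟩
    swap
    · exact hx.elim
    -- The point character of `x` lies in the coincidence set, so some `Y` of the subcover has value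
    -- `1` at it, that is, `x ∈ Y`.
    have hxK : point σ x ∈ K := ⟨point_mem_boundary x, point_eq_true.2 ⟨x, hXφ hx⟩⟩
    have hxe : sec φ (fun χ => χ.2.2) ⟨_, hxK⟩ = sec .one (fun χ => hone χ) ⟨_, hxK⟩ := by
      refine Subtype.ext (mk_eq_mk_iff.2 ⟨rfl, ⟨X, hX⟩, fun y hy => ?_, point_eq_true.2 hx⟩)
      exact Option.mem_def.1 (hXφ hy)
    obtain ⟨Y, hY, hxY⟩ := mem_iUnion₂.1 (ht hxe)
    have hxY' : x ∈ Y.1.1 := point_eq_true.1 hxY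
    refine mem_iUnion.2 ⟨e ⟨Y, hY, x, hxY'⟩, ?_⟩
    rw [← hgC, e.symm_apply_apply]
    exact hxY'
  · refine iUnion_subset fun i => ?_
    rw [← hgC]
    exact subset_sUnion_of_mem (.inl ⟨(e.symm i).1.1.2, (e.symm i).1.2⟩)

end AlgAct

theorem mainTheorem5 {S : Type*} {G : Type*} [Monoid S] [Group G] [Nontrivial G]
    (σ : AlgAct.AlgebraicAction S G) (hfaithful : σ.IsFaithful)
    (hσ : ¬ σ.IsAutomorphic) :
    T2Space (AlgAct.TightGroupoid σ) ↔ AlgAct.ConditionH σ :=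
  ⟨fun _ => AlgAct.conditionH_of_t2Space, AlgAct.t2Space_of_conditionH⟩
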